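/- Let $d\in\mathbb{N}$ and work in $\mathbb{R}^d$ with the Euclidean norm. Write $B(x,\delta)$ for the open ball with centre $x$ and radius $\delta$, and for bounded $A\subset\mathbb{R}^d$ and $\delta>0$ let $N_\delta(A)$ be the least number of open balls of radius $\delta$ needed to cover $A$. For nonempty $F\subset\mathbb{R}^d$ and $\theta\in(0,1)$, the upper Assouad spectrum of $F$ at $\theta$ is $$\overline{\dim}_{\mathrm A}^{\theta}F=\inf\Bigl\{\alpha\in\mathbb{R}:(\exists C>0)(\forall\, 0<\delta\le 1)(\forall\, 0<\delta'\le\delta^{1/\theta})(\forall x\in F)\ N_{\delta'}\bigl(F\cap B(x,\delta)\bigr)\le C\Bigl(\frac{\delta}{\delta'}\Bigr)^{\alpha}\Bigr\}.$$ For $\kappa\in[0,d]$ and $c\in(0,1)$, define $f_{(\kappa,c)}:(0,1)\to\mathbb{R}$ by $f_{(\kappa,c)}(\theta)=\kappa(1-c)$ for $0<\theta\le c$ and $f_{(\kappa,c)}(\theta)=\kappa(1-\theta)$ for $c<\theta<1$. Let $\varphi:(0,1)\to[0,d]$ be an arbitrary function. Then the following are equivalent: (a) There exists a nonempty set $F\subset\mathbb{R}^d$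 such that $\overline{\dim}_{\mathrm A}^{\theta}F=\varphi(\theta)$ for all $\theta\in(0,1)$. (b) $\varphi$ is increasing and $\theta\mapsto(1-\theta)\varphi(\theta)$ is decreasing on $(0,1)$ (both in the non-strict sense). (c) $\varphi$ is the pointwise supremum of a (nonempty) family of functions of the form $\theta\mapsto f_{(\kappa,c)}(\theta)/(1-\theta)$ with $\kappa\in[0,d]$ and $c\in(0,1)$; that is, there is a nonempty set $P\subset[0,d]\times(0,1)$ with $\varphi(\theta)=\sup_{(\kappa,c)\in P} f_{(\kappa,c)}(\theta)/(1-\theta)$ for all $\theta\in(0,1)$. -/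

import Mathlib

namespace AssouadSpec

/-- The cardinalities of the finite families of open balls of radius `δ` that cover `A`. -/
def coverSizes {d : ℕ} (δ : ℝ) (A : Set (EuclideanSpace ℝ (Fin d))) : Set ℕ :=
  {n | ∃ s : Finset (EuclideanSpace ℝ (Fin d)), s.card = n ∧ A ⊆ ⋃ x ∈ s, Metric.ball x δ}

/-- `N_δ(A)`: the least number of open balls of radius `δ` in `ℝ^d` that cover the bounded
set `A`. It is only used for bounded `A` and `δ > 0`, when a finite cover exists. -/
noncomputable def coverNumber {d : ℕ} (δ : ℝ) (A : Set (EuclideanSpace ℝ (Fin d))) : ℕ :=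
  sInf (coverSizes δ A)

theorem coverSizes_nonempty {d : ℕ} {δ : ℝ} (hδ : 0 < δ) {A : Set (EuclideanSpace ℝ (Fin d))}
    (hA : Bornology.IsBounded A) : (coverSizes δ A).Nonempty := by
  obtain ⟨t, ht, hAt⟩ :=
    Metric.totallyBounded_iff.1 (hA.isCompact_closure.totallyBounded.subset subset_closure) δ hδ
  exact ⟨_, ht.toFinset, rfl, by simpa using hAt⟩

/-- The set of exponents `α` for which there is a constant `C > 0` such that
`N_{δ'}(F ∩ B(x, δ)) ≤ C (δ / δ') ^ α` for all `0 < δ ≤ 1`, all `0 < δ' ≤ δ ^ (1 / θ)`,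
and all `x ∈ F`. -/
def upperAssouadExponents {d : ℕ} (θ : ℝ) (F : Set (EuclideanSpace ℝ (Fin d))) : Set ℝ :=
  {α | ∃ C : ℝ, 0 < C ∧ ∀ δ : ℝ, 0 < δ → δ ≤ 1 → ∀ δ' : ℝ, 0 < δ' → δ' ≤ δ ^ (1 / θ) →
    ∀ x ∈ F, (coverNumber δ' (F ∩ Metric.ball x δ) : ℝ) ≤ C * (δ / δ') ^ α}

/-- The upper Assouad spectrum of `F` at `θ ∈ (0, 1)`. For nonempty `F ⊆ ℝ^d` the set of exponents
is contained in `[0, ∞)` and contains `d`, so that this is an infimum in the usual sense. -/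
noncomputable def upperAssouadSpectrum {d : ℕ} (θ : ℝ) (F : Set (EuclideanSpace ℝ (Fin d))) : ℝ :=
  sInf (upperAssouadExponents θ F)

/-- The function `f_{(κ, c)}`. -/
noncomputable def spectrumFun (κ c θ : ℝ) : ℝ :=
  if θ ≤ c then κ * (1 - c) else κ * (1 - θ)

end AssouadSpec

/-! (a) ⇒ (b): raising θ admits more pairs of scales, hence fewer exponents. If δ' > δ^(1/θ₁), the
ball of radius δ lies in the one of radius δ'^θ₁, and this turns an exponent α at θ₁ into
α(1-θ₁)/(1-θ₂) at θ₂.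

(b) ⇔ (c): each f_(κ,c)(θ)/(1-θ) has both monotonicity properties, and suprema preserve them.
Conversely, (b) says exactly that the functions with κ = φ(c) stay below φ, and each touches it at θ
= c.

(b) ⇒ (a) is the main work. `exists_homogeneous_set` supplies Cantor-like sets that look
κ-dimensional between the scales ρ and ρ^c, with constants depending only on d.
`exists_set_of_monotoneOn_of_antitoneOn` places such sets far apart, with c rational, κ = φ(c) and
arbitrarily small ρ. At θ, pieces with c ≤ θ are controlled by φ(c) ≤ φ(θ), and pieces with c ≥ θ by
their total size and (1-c)φ(c) ≤ (1-θ)φ(θ). The scales ρ^c and ρ show that the spectrum at c is at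
least φ(c); monotonicity carries this from rational c to every θ. -/

namespace AssouadSpec

/-! ### Covering numbers and products -/

section CoverNumber

variable {d : ℕ}

theorem coverNumber_le {δ : ℝ} {A : Set (EuclideanSpace ℝ (Fin d))}
    (s : Finset (EuclideanSpace ℝ (Fin d))) (h : A ⊆ ⋃ x ∈ s, Metric.ball x δ) :
    coverNumber δ A ≤ s.card :=
  Nat.sInf_le ⟨s, rfl, h⟩

theorem exists_cover {δ : ℝ} (hδ : 0 < δ) {A : Set (EuclideanSpace ℝ (Fin d))}
    (hA : Bornology.IsBounded A) :
    ∃ s : Finset (EuclideanSpace ℝ (Fin d)),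
      s.card = coverNumber δ A ∧ A ⊆ ⋃ x ∈ s, Metric.ball x δ :=
  Nat.sInf_mem (coverSizes_nonempty hδ hA)

theorem isBounded_inter_ball (F : Set (EuclideanSpace ℝ (Fin d)))
    (x : EuclideanSpace ℝ (Fin d)) (δ : ℝ) : Bornology.IsBounded (F ∩ Metric.ball x δ) :=
  Metric.isBounded_ball.subset Set.inter_subset_right

theorem coverNumber_mono {δ : ℝ} (hδ : 0 < δ) {A B : Set (EuclideanSpace ℝ (Fin d))}
    (hB : Bornology.IsBounded B) (hAB : A ⊆ B) : coverNumber δ A ≤ coverNumber δ B := by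
  obtain ⟨s, hs, hc⟩ := exists_cover hδ hB
  exact hs ▸ coverNumber_le s (hAB.trans hc)

theorem one_le_coverNumber {δ : ℝ} (hδ : 0 < δ) {A : Set (EuclideanSpace ℝ (Fin d))}
    (hA : Bornology.IsBounded A) (hne : A.Nonempty) : 1 ≤ coverNumber δ A := by
  obtain ⟨s, hs, hc⟩ := exists_cover hδ hA
  obtain ⟨a, ha⟩ := hne
  have := hc ha
  simp only [Set.mem_iUnion, exists_prop] at this
  obtain ⟨x, hx, -⟩ := this
  exact hs ▸ Finset.card_pos.2 ⟨x, hx⟩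

theorem coverNumber_preimage_sub_le {δ : ℝ} (hδ : 0 < δ) {A : Set (EuclideanSpace ℝ (Fin d))}
    (hA : Bornology.IsBounded A) (v : EuclideanSpace ℝ (Fin d)) :
    coverNumber δ {y | y - v ∈ A} ≤ coverNumber δ A := by
  classical
  obtain ⟨s, hs, hc⟩ := exists_cover hδ hA
  rw [← hs]
  refine (coverNumber_le (s.image (· + v)) ?_).trans Finset.card_image_le
  intro y hy
  have := hc hy
  simp only [Set.mem_iUnion, exists_prop, Metric.mem_ball] at this
  obtain ⟨x, hx, hd⟩ := this
  simp only [Set.mem_iUnion, exists_prop, Metric.mem_ball]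
  refine ⟨x + v, Finset.mem_image_of_mem _ hx, ?_⟩
  rwa [dist_eq_norm, show y - (x + v) = y - v - x by abel, ← dist_eq_norm]

theorem abs_coord_sub_le_dist (x y : EuclideanSpace ℝ (Fin d)) (k : Fin d) :
    |x k - y k| ≤ dist x y := by
  rw [dist_eq_norm]
  exact PiLp.norm_apply_le (x - y) k

theorem dist_lt_of_abs_coord_sub_le {x y : EuclideanSpace ℝ (Fin d)} {w δ : ℝ} (hw : 0 ≤ w)
    (hδ : d * w < δ) (h : ∀ k, |x k - y k| ≤ w) : dist x y < δ := by
  refine lt_of_le_of_lt ?_ hδ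
  rw [EuclideanSpace.dist_eq]
  refine Real.sqrt_le_iff.2 ⟨by positivity, ?_⟩
  calc ∑ k, dist (x k) (y k) ^ 2 ≤ ∑ _k : Fin d, w ^ 2 :=
        Finset.sum_le_sum fun k _ => pow_le_pow_left₀ dist_nonneg (by
          rw [Real.dist_eq]; exact h k) 2
    _ = d * w ^ 2 := by simp
    _ ≤ (d * w) ^ 2 := by
        rw [mul_pow]
        gcongr
        exact_mod_cast Nat.le_self_pow two_ne_zero d

/-- Coordinatewise covers of a set give a cover by products. -/
theorem coverNumber_le_pow {δ w : ℝ} {M : ℕ} {A : Set (EuclideanSpace ℝ (Fin d))} (hw : 0 ≤ w)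
    (hδ : d * w < δ)
    (h : ∀ k : Fin d, ∃ t : Finset ℝ, t.card ≤ M ∧ ∀ y ∈ A, ∃ c ∈ t, |y k - c| ≤ w) :
    coverNumber δ A ≤ M ^ d := by
  classical
  choose t ht hc using h
  refine (coverNumber_le ((Fintype.piFinset t).image (WithLp.toLp 2)) ?_).trans ?_
  · intro y hy
    choose c hct hcw using fun k => hc k y hy
    simp only [Set.mem_iUnion, exists_prop, Metric.mem_ball]
    exact ⟨WithLp.toLp 2 c, Finset.mem_image_of_mem _ (Fintype.mem_piFinset.2 hct),
      dist_lt_of_abs_coord_sub_le hw hδ hcw⟩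
  · refine Finset.card_image_le.trans ?_
    rw [Fintype.card_piFinset]
    exact (Finset.prod_le_prod' fun k _ => ht k).trans (by simp)

theorem exists_finset_cover_interval {a b w : ℝ} (hw : 0 < w) (hab : a ≤ b) :
    ∃ t : Finset ℝ, (t.card : ℝ) ≤ (b - a) / w + 1 ∧
      ∀ y ∈ Set.Ioo a b, ∃ c ∈ t, |y - c| ≤ w := by
  classical
  refine ⟨(Finset.range (⌊(b - a) / w⌋₊ + 1)).image fun n : ℕ => a + n * w, ?_, ?_⟩
  · calc _ ≤ ((Finset.range (⌊(b - a) / w⌋₊ + 1)).card : ℝ) := by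
          exact_mod_cast Finset.card_image_le
      _ ≤ _ := by
          simp only [Finset.card_range, Nat.cast_add, Nat.cast_one]
          gcongr
          exact Nat.floor_le (div_nonneg (by linarith) hw.le)
  · intro y hy
    have h0 : 0 ≤ (y - a) / w := div_nonneg (by linarith [hy.1]) hw.le
    refine ⟨a + ⌊(y - a) / w⌋₊ * w, Finset.mem_image_of_mem _ (Finset.mem_range.2 ?_), ?_⟩
    · refine Nat.lt_succ_of_le (Nat.floor_le_floor ?_)
      gcongr
      exact hy.2.le
    · have h1 := Nat.floor_le h0
      have h2 := (Nat.lt_floor_add_one ((y - a) / w)).le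
      rw [le_div_iff₀ hw] at h1
      rw [div_le_iff₀ hw] at h2
      rw [abs_le]
      constructor <;> linarith

theorem coverNumber_inter_ball_le (F : Set (EuclideanSpace ℝ (Fin d)))
    (x : EuclideanSpace ℝ (Fin d)) {δ δ' : ℝ} (hδ' : 0 < δ') (hδ : δ' ≤ δ) :
    (coverNumber δ' (F ∩ Metric.ball x δ) : ℝ) ≤
      (2 * (d + 1) + 1) ^ d * (δ / δ') ^ (d : ℝ) := by
  have hδ0 : 0 < δ := hδ'.trans_le hδ
  have hw : 0 < δ' / (d + 1) := by positivity
  set B : ℝ := (2 * δ) / (δ' / (d + 1)) + 1 with hB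
  have hB0 : 0 ≤ B := by positivity
  have h1 : coverNumber δ' (F ∩ Metric.ball x δ) ≤ ⌊B⌋₊ ^ d := by
    refine coverNumber_le_pow hw.le ?_ fun k => ?_
    · rw [mul_div_assoc', div_lt_iff₀ (by positivity)]
      nlinarith
    · obtain ⟨t, ht, hc⟩ := exists_finset_cover_interval (a := x k - δ) (b := x k + δ) hw
        (by linarith)
      refine ⟨t, Nat.le_floor (ht.trans_eq (by rw [hB]; ring)), fun y hy => hc _ ?_⟩
      have := (abs_coord_sub_le_dist y x k).trans_lt (Metric.mem_ball.1 hy.2)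
      rw [abs_lt] at this
      constructor <;> linarith
  have h2 : B ≤ (2 * (d + 1) + 1) * (δ / δ') := by
    have : 1 ≤ δ / δ' := (one_le_div hδ').2 hδ
    have e : (2 * δ) / (δ' / (d + 1)) = 2 * (d + 1) * (δ / δ') := by
      field_simp
    rw [hB, e]
    linarith
  calc (coverNumber δ' (F ∩ Metric.ball x δ) : ℝ) ≤ (⌊B⌋₊ : ℝ) ^ d := by exact_mod_cast h1
    _ ≤ B ^ d := by gcongr; exact Nat.floor_le hB0
    _ ≤ ((2 * (d + 1) + 1) * (δ / δ')) ^ d := by gcongr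
    _ = _ := by rw [mul_pow, Real.rpow_natCast]

end CoverNumber

/-! ### Monotonicity properties of the spectrum -/

section Exponents

variable {d : ℕ} {θ : ℝ} {F : Set (EuclideanSpace ℝ (Fin d))}

theorem rpow_one_div_le_self {δ : ℝ} (hθ : θ ∈ Set.Ioo (0 : ℝ) 1) (hδ : 0 < δ) (hδ1 : δ ≤ 1) :
    δ ^ (1 / θ) ≤ δ := by
  conv_rhs => rw [← Real.rpow_one δ]
  exact Real.rpow_le_rpow_of_exponent_ge hδ hδ1 ((one_le_div hθ.1).2 hθ.2.le)

theorem natCast_mem_upperAssouadExponents (hθ : θ ∈ Set.Ioo (0 : ℝ) 1) :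
    (d : ℝ) ∈ upperAssouadExponents θ F :=
  ⟨(2 * (d + 1) + 1) ^ d, by positivity, fun _ hδ hδ1 _ hδ' hle x _ =>
    coverNumber_inter_ball_le F x hδ' (hle.trans (rpow_one_div_le_self hθ hδ hδ1))⟩

/-- An exponent bounding an unbounded power from above is at least as large. -/
theorem le_of_forall_rpow_le {α κ C : ℝ}
    (h : ∀ R : ℝ, ∃ t : ℝ, R < t ∧ t ^ κ ≤ C * t ^ α) : κ ≤ α := by
  by_contra! hlt
  have hp : 0 < κ - α := sub_pos.2 hlt
  obtain ⟨R, hR⟩ := Filter.eventually_atTop.1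
    ((tendsto_rpow_atTop hp).eventually_gt_atTop C)
  obtain ⟨t, ht, hle⟩ := h (max R 1)
  have ht0 : 0 < t := by linarith [le_max_right R 1]
  have h1 := hR t ((le_max_left _ _).trans ht.le)
  rw [Real.rpow_sub ht0, lt_div_iff₀ (Real.rpow_pos_of_pos ht0 _)] at h1
  linarith

/-- Take δ = 1 and let δ' tend to 0: the covering number stays at least 1, so the powers of 1/δ'
cannot decay. -/
theorem nonneg_of_mem_upperAssouadExponents (hF : F.Nonempty) {α : ℝ}
    (hα : α ∈ upperAssouadExponents θ F) : 0 ≤ α := by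
  obtain ⟨C, -, h⟩ := hα
  obtain ⟨x, hx⟩ := hF
  refine le_of_forall_rpow_le (C := C) fun R => ⟨max R 1 + 1, by linarith [le_max_left R 1], ?_⟩
  have hR : 0 < max R 1 + 1 := by linarith [le_max_right R 1]
  have h1 := h 1 one_pos le_rfl (1 / (max R 1 + 1)) (by positivity) (by
    rw [Real.one_rpow, div_le_one hR]; linarith [le_max_right R 1]) x hx
  rw [one_div_one_div] at h1
  rw [Real.rpow_zero]
  refine le_trans ?_ h1
  exact_mod_cast one_le_coverNumber (by positivity) (isBounded_inter_ball _ _ _)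
    ⟨x, hx, Metric.mem_ball_self one_pos⟩

theorem bddBelow_upperAssouadExponents (hF : F.Nonempty) :
    BddBelow (upperAssouadExponents θ F) :=
  ⟨0, fun _ hα => nonneg_of_mem_upperAssouadExponents hF hα⟩

theorem monotoneOn_upperAssouadSpectrum (hF : F.Nonempty) :
    MonotoneOn (fun θ => upperAssouadSpectrum θ F) (Set.Ioo (0 : ℝ) 1) := by
  intro θ₁ h₁ θ₂ h₂ hle
  refine csInf_le_csInf (bddBelow_upperAssouadExponents hF)
    ⟨_, natCast_mem_upperAssouadExponents h₂⟩ ?_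
  rintro α ⟨C, hC, h⟩
  refine ⟨C, hC, fun δ hδ hδ1 δ' hδ' hd => h δ hδ hδ1 δ' hδ' (hd.trans ?_)⟩
  exact Real.rpow_le_rpow_of_exponent_ge hδ hδ1 (one_div_le_one_div_of_le h₁.1 hle)

theorem rpow_sub_one_le_div {δ δ' : ℝ} (hθ : θ ∈ Set.Ioo (0 : ℝ) 1) (hδ : 0 < δ)
    (hδ' : 0 < δ') (h : δ' ≤ δ ^ (1 / θ)) : δ' ^ (θ - 1) ≤ δ / δ' := by
  rw [Real.rpow_sub_one hδ'.ne']
  gcongr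
  calc δ' ^ θ ≤ (δ ^ (1 / θ)) ^ θ := Real.rpow_le_rpow hδ'.le h hθ.1.le
    _ = δ := by
      rw [← Real.rpow_mul hδ.le, one_div_mul_cancel hθ.1.ne', Real.rpow_one]

theorem antitoneOn_upperAssouadSpectrum (hF : F.Nonempty) :
    AntitoneOn (fun θ => (1 - θ) * upperAssouadSpectrum θ F) (Set.Ioo (0 : ℝ) 1) := by
  intro θ₁ h₁ θ₂ h₂ hle
  have p₁ : 0 < 1 - θ₁ := sub_pos.2 h₁.2
  have p₂ : 0 < 1 - θ₂ := sub_pos.2 h₂.2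
  have key : ∀ α ∈ upperAssouadExponents θ₁ F,
      α * (1 - θ₁) / (1 - θ₂) ∈ upperAssouadExponents θ₂ F := by
    intro α hα
    have hα0 := nonneg_of_mem_upperAssouadExponents hF hα
    obtain ⟨C, hC, h⟩ := hα
    refine ⟨C, hC, fun δ hδ hδ1 δ' hδ' hd x hx => ?_⟩
    have hδδ : δ' ≤ δ := hd.trans (rpow_one_div_le_self h₂ hδ hδ1)
    have hα' : α ≤ α * (1 - θ₁) / (1 - θ₂) := by
      rw [le_div_iff₀ p₂]
      gcongr
    rcases le_or_gt δ' (δ ^ (1 / θ₁)) with hc | hc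
    · refine (h δ hδ hδ1 δ' hδ' hc x hx).trans ?_
      gcongr
      exact (one_le_div hδ').2 hδδ
    · have hδ'1 : δ' ≤ 1 := hδδ.trans hδ1
      -- The pair (δ, δ') is not admissible at θ₁; enlarging δ to δ'^θ₁ makes it just admissible.
      have hlt : δ ≤ δ' ^ θ₁ := by
        calc δ = (δ ^ (1 / θ₁)) ^ θ₁ := by
              rw [← Real.rpow_mul hδ.le, one_div_mul_cancel h₁.1.ne', Real.rpow_one]
          _ ≤ δ' ^ θ₁ := Real.rpow_le_rpow (by positivity) hc.le h₁.1.le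
      have h2 := h (δ' ^ θ₁) (by positivity) (Real.rpow_le_one hδ'.le hδ'1 h₁.1.le) δ' hδ'
        (by rw [← Real.rpow_mul hδ'.le, mul_one_div_cancel h₁.1.ne', Real.rpow_one]) x hx
      have h3 : (coverNumber δ' (F ∩ Metric.ball x δ) : ℝ) ≤
          coverNumber δ' (F ∩ Metric.ball x (δ' ^ θ₁)) := by
        exact_mod_cast coverNumber_mono hδ' (isBounded_inter_ball _ _ _)
          (Set.inter_subset_inter_right _ (Metric.ball_subset_ball hlt))
      refine h3.trans (h2.trans ?_)
      gcongr
      rw [← Real.rpow_sub_one hδ'.ne']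
      calc (δ' ^ (θ₁ - 1)) ^ α = (δ' ^ (θ₂ - 1)) ^ (α * (1 - θ₁) / (1 - θ₂)) := by
            rw [← Real.rpow_mul hδ'.le, ← Real.rpow_mul hδ'.le]
            congr 1
            field_simp
            ring
        _ ≤ _ := by
            refine Real.rpow_le_rpow (by positivity) (rpow_sub_one_le_div h₂ hδ hδ' hd) ?_
            positivity
  show (1 - θ₂) * sInf _ ≤ (1 - θ₁) * sInf _
  rw [← div_le_iff₀' p₁]
  refine le_csInf ⟨_, natCast_mem_upperAssouadExponents h₁⟩ fun α hα => ?_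
  have := csInf_le (bddBelow_upperAssouadExponents hF) (key α hα)
  rw [le_div_iff₀ p₂] at this
  rw [div_le_iff₀ p₁]
  linarith

end Exponents

/-! ### Binary digits read in a larger base -/

section DigitMap

/-- The binary digits of `n`, read in base `b`. -/
noncomputable def digitMap (b : ℝ) (n : ℕ) : ℝ :=
  Nat.ofDigits b (Nat.digits 2 n)

variable {b : ℝ}

@[simp] theorem digitMap_zero : digitMap b 0 = 0 := by
  simp [digitMap, Nat.ofDigits]

theorem digitMap_eq (n : ℕ) : digitMap b n = b * digitMap b (n / 2) + (n % 2 : ℕ) := by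
  rcases Nat.eq_zero_or_pos n with rfl | hn
  · simp
  · rw [digitMap, Nat.digits_def' one_lt_two hn, digitMap]
    change ((n % 2 : ℕ) : ℝ) + b * _ = _
    rw [add_comm]

/-- Strip the last digit: if the rest agrees, the last digits are 0 and 1; otherwise the rest gains
at least b ≥ 2 and the last digit loses at most 1. -/
theorem digitMap_add_one_le (hb : 2 ≤ b) (n : ℕ) :
    ∀ m < n, digitMap b m + 1 ≤ digitMap b n := by
  induction n using Nat.strong_induction_on with
  | _ n ih =>
    intro m hmn
    rw [digitMap_eq m, digitMap_eq n]
    rcases (Nat.div_le_div_right hmn.le : m / 2 ≤ n / 2).eq_or_lt with h | h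
    · have h1 : m % 2 = 0 := by omega
      have h2 : n % 2 = 1 := by omega
      rw [h, h1, h2]
      simp
    · have h1 := ih (n / 2) (by omega) (m / 2) h
      have h2 : ((m % 2 : ℕ) : ℝ) ≤ 1 := by
        exact_mod_cast Nat.le_of_lt_succ (Nat.mod_lt m two_pos)
      have h3 : (0 : ℝ) ≤ ((n % 2 : ℕ) : ℝ) := Nat.cast_nonneg _
      nlinarith

theorem digitMap_add_sub_le (hb : 2 ≤ b) (m k : ℕ) :
    digitMap b m + k ≤ digitMap b (m + k) := by
  induction k with
  | zero => simp
  | succ k ih =>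
    have := digitMap_add_one_le hb (m + k + 1) (m + k) (Nat.lt_succ_self _)
    push_cast
    rw [← add_assoc m k 1]
    linarith

theorem one_le_abs_digitMap_sub (hb : 2 ≤ b) {m n : ℕ} (h : m ≠ n) :
    1 ≤ |digitMap b m - digitMap b n| := by
  rcases h.lt_or_gt with h | h
  · rw [abs_sub_comm]
    exact le_trans (by linarith [digitMap_add_one_le hb n m h]) (le_abs_self _)
  · exact le_trans (by linarith [digitMap_add_one_le hb m n h]) (le_abs_self _)

/-- The difference is the contribution of the i lowest digits, at most 1 + b + ... + b^(i-1), which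
is at most b^i - 1 because b ≥ 2. -/
theorem digitMap_sub_mem_Icc (hb : 2 ≤ b) (i n : ℕ) :
    digitMap b n - b ^ i * digitMap b (n / 2 ^ i) ∈ Set.Icc 0 (b ^ i - 1) := by
  induction i generalizing n with
  | zero => simp
  | succ i ih =>
    have h := ih (n / 2)
    rw [Nat.div_div_eq_div_mul, ← pow_succ'] at h
    have h2 : ((n % 2 : ℕ) : ℝ) ≤ 1 := by
      exact_mod_cast Nat.le_of_lt_succ (Nat.mod_lt n two_pos)
    have h3 : (0 : ℝ) ≤ ((n % 2 : ℕ) : ℝ) := Nat.cast_nonneg _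
    rw [digitMap_eq n, pow_succ' b]
    constructor
    · have := mul_nonneg (by linarith : 0 ≤ b) h.1
      nlinarith
    · have := mul_le_mul_of_nonneg_left h.2 (by linarith : 0 ≤ b)
      nlinarith

theorem digitMap_mem_Icc (hb : 2 ≤ b) {m n : ℕ} (hn : n < 2 ^ m) :
    digitMap b n ∈ Set.Icc 0 (b ^ m - 1) := by
  have := digitMap_sub_mem_Icc hb m n
  rwa [Nat.div_eq_of_lt hn, digitMap_zero, mul_zero, sub_zero] at this

/-- The points of the digit set in an interval of length about `b ^ j` are covered by `3 * 2 ^ (j - i)`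
intervals of length about `b ^ i`. -/
theorem exists_finset_cover_digitMap (hb : 2 ≤ b) {m i j : ℕ} (hij : i ≤ j) {x δ : ℝ}
    (h : δ ≤ b ^ j ∨ m ≤ j) :
    ∃ t : Finset ℝ, t.card ≤ 3 * 2 ^ (j - i) ∧
      ∀ n < 2 ^ m, |digitMap b n - x| < δ → ∃ c ∈ t, |digitMap b n - c| ≤ b ^ i - 1 := by
  classical
  have hbj : 0 < b ^ j := by positivity
  -- Here q is the least leading part n / 2^j that occurs. Leading parts 3 apart would put two
  -- points more than 2b^j ≥ 2δ apart, so only three can occur.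
  obtain ⟨q, hq⟩ : ∃ q : ℕ, ∀ n < 2 ^ m, |digitMap b n - x| < δ →
      q ≤ n / 2 ^ j ∧ n / 2 ^ j < q + 3 := by
    rcases h with h | h
    · by_cases hne : ∃ q n : ℕ, n / 2 ^ j = q ∧ |digitMap b n - x| < δ
      · refine ⟨Nat.find hne, fun n _ hnx => ⟨Nat.find_min' hne ⟨n, rfl, hnx⟩, ?_⟩⟩
        obtain ⟨n₀, hn₀, hnx₀⟩ := Nat.find_spec hne
        by_contra! hlt
        obtain ⟨k, hk⟩ := Nat.exists_eq_add_of_le hlt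
        have h1 := digitMap_add_sub_le hb (Nat.find hne) (3 + k)
        rw [← add_assoc, ← hk, ← hn₀] at h1
        have h2 := digitMap_sub_mem_Icc hb j n
        have h3 := digitMap_sub_mem_Icc hb j n₀
        push_cast at h1
        have h4 : (0 : ℝ) ≤ k := Nat.cast_nonneg k
        have h5 : b ^ j * (digitMap b (n₀ / 2 ^ j) + 3) ≤ b ^ j * digitMap b (n / 2 ^ j) := by
          gcongr
          linarith
        rw [abs_lt] at hnx hnx₀
        linarith [h2.1, h3.2]
      · push Not at hne
        exact ⟨0, fun n _ hnx => absurd hnx (not_lt.2 (hne _ n rfl))⟩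
    · refine ⟨0, fun n hn _ => ⟨Nat.zero_le _, ?_⟩⟩
      rw [Nat.div_eq_of_lt (hn.trans_le (Nat.pow_le_pow_right two_pos h))]
      norm_num
  refine ⟨(Finset.Ico (q * 2 ^ (j - i)) ((q + 3) * 2 ^ (j - i))).image
    fun k => b ^ i * digitMap b k, ?_, fun n hn hnx => ?_⟩
  · refine Finset.card_image_le.trans ?_
    rw [Nat.card_Ico, ← Nat.sub_mul, Nat.add_sub_cancel_left]
  · obtain ⟨h1, h2⟩ := hq n hn hnx
    have e : n / 2 ^ j = n / 2 ^ i / 2 ^ (j - i) := by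
      rw [Nat.div_div_eq_div_mul, ← pow_add, Nat.add_sub_cancel' hij]
    rw [e] at h1 h2
    have hp : 0 < 2 ^ (j - i) := by positivity
    refine ⟨_, Finset.mem_image_of_mem _ (Finset.mem_Ico.2
      ⟨(Nat.le_div_iff_mul_le hp).1 h1, (Nat.div_lt_iff_lt_mul hp).1 h2⟩), ?_⟩
    have h3 := digitMap_sub_mem_Icc hb i n
    rw [abs_of_nonneg h3.1]
    exact h3.2

end DigitMap

/-! ### Homogeneous Cantor-like sets -/

section DigitSet

/-- The points all of whose coordinates are `ρ` times a number with at most `m` binary digits,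
read in base `b`. -/
def digitSet (d : ℕ) (b ρ : ℝ) (m : ℕ) : Set (EuclideanSpace ℝ (Fin d)) :=
  {y | ∀ k, ∃ n < 2 ^ m, y k = ρ * digitMap b n}

variable {d : ℕ} {b ρ κ : ℝ} {m : ℕ}

theorem zero_mem_digitSet : (0 : EuclideanSpace ℝ (Fin d)) ∈ digitSet d b ρ m :=
  fun _ => ⟨0, by positivity, by simp⟩

theorem digitSet_subset_ball (hb : 2 ≤ b) (hρ : 0 < ρ) :
    digitSet d b ρ m ⊆ Metric.ball 0 ((d + 1) * (ρ * b ^ m)) := by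
  intro y hy
  have hp : 0 < ρ * b ^ m := by positivity
  refine dist_lt_of_abs_coord_sub_le hp.le (by linarith) fun k => ?_
  obtain ⟨n, hn, e⟩ := hy k
  have h := digitMap_mem_Icc hb hn
  rw [e, PiLp.zero_apply, sub_zero, abs_of_nonneg (mul_nonneg hρ.le h.1)]
  gcongr
  linarith [h.2]

/-- Distinct points differ by at least ρ in some coordinate, so a ball of radius ρ/2 contains at
most one. -/
theorem pow_le_coverNumber_digitSet (hb : 2 ≤ b) (hρ : 0 < ρ) :
    (2 ^ m) ^ d ≤ coverNumber (ρ / 2) (digitSet d b ρ m) := by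
  classical
  obtain ⟨s, hs, hc⟩ := exists_cover (half_pos hρ)
    (Metric.isBounded_ball.subset (digitSet_subset_ball (d := d) (m := m) hb hρ))
  rw [← hs]
  let g : (Fin d → Fin (2 ^ m)) → EuclideanSpace ℝ (Fin d) :=
    fun v => WithLp.toLp 2 fun k => ρ * digitMap b (v k)
  have hg : ∀ v, ∃ z ∈ s, dist (g v) z < ρ / 2 := fun v => by
    have := hc (show g v ∈ digitSet d b ρ m from fun k => ⟨v k, (v k).2, rfl⟩)
    simpa using this
  choose z hz hd using hg
  have hinj : Function.Injective z := by
    intro v w hvw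
    by_contra hne
    obtain ⟨k, hk⟩ := Function.ne_iff.1 hne
    have h1 : dist (g v) (g w) < ρ := by
      have := dist_triangle_right (g v) (g w) (z v)
      have h2 := hd w
      rw [← hvw] at h2
      linarith [hd v]
    have h2 := (abs_coord_sub_le_dist (g v) (g w) k).trans_lt h1
    have h3 : |g v k - g w k| = ρ * |digitMap b (v k) - digitMap b (w k)| := by
      change |ρ * _ - ρ * _| = _
      rw [← mul_sub, abs_mul, abs_of_pos hρ]
    have h4 := one_le_abs_digitMap_sub hb (fun e => hk (Fin.ext e) : (v k : ℕ) ≠ w k)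
    rw [h3] at h2
    nlinarith
  calc (2 ^ m) ^ d = (Finset.univ : Finset (Fin d → Fin (2 ^ m))).card := by simp
    _ ≤ s.card := Finset.card_le_card_of_injOn z (fun v _ => hz v) hinj.injOn

/-- In units of ρ, R bounds the ratio of the outer scale to the resolution. With b^l ≤ R < b^(l+1),
each coordinate needs at most 3 * 2^(l+2) = 12 * 2^l intervals, and 2^(ld) = (b^l)^κ. -/
theorem coverNumber_digitSet_le (hb : 2 ≤ b) (hκ : 0 ≤ κ) (hbκ : b ^ κ = 2 ^ d) (hρ : 0 < ρ)
    (x : EuclideanSpace ℝ (Fin d)) {δ δ' R : ℝ} (hδ' : 0 < δ') (hR1 : 1 ≤ R)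
    (hR : min (δ / ρ) (b ^ m) ≤ R * max 1 (δ' / ((d + 1) * ρ))) :
    (coverNumber δ' (digitSet d b ρ m ∩ Metric.ball x δ) : ℝ) ≤ 12 ^ d * R ^ κ := by
  have hb0 : 0 < b := by linarith
  have hb1 : 1 < b := by linarith
  set T := max 1 (δ' / ((d + 1) * ρ)) with hT
  have hT1 : 1 ≤ T := le_max_left _ _
  have hT0 : 0 < T := by linarith
  obtain ⟨i, hi, hi'⟩ := exists_nat_pow_near hT1 hb1
  obtain ⟨l, hl, hl'⟩ := exists_nat_pow_near hR1 hb1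
  have hRT : min (δ / ρ) (b ^ m) ≤ b ^ (i + l + 2) := by
    refine hR.trans ?_
    calc R * T ≤ b ^ (l + 1) * b ^ (i + 1) := by gcongr
      _ = _ := by ring
  have hj : δ / ρ ≤ b ^ (i + l + 2) ∨ m ≤ i + l + 2 :=
    (min_le_iff.1 hRT).imp_right (pow_le_pow_iff_right₀ hb1).1
  have hw : 0 ≤ b ^ i - 1 := sub_nonneg.2 (one_le_pow₀ hb1.le)
  have hN : coverNumber δ' (digitSet d b ρ m ∩ Metric.ball x δ) ≤ (3 * 2 ^ (l + 2)) ^ d := by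
    refine coverNumber_le_pow (w := ρ * (b ^ i - 1)) (mul_nonneg hρ.le hw) ?_ fun k => ?_
    -- If the maximum is 1, then b^i = 1 and the intervals degenerate to points, so an arbitrarily
    -- small δ' is allowed.
    · rcases max_cases 1 (δ' / ((d + 1) * ρ)) with ⟨e, -⟩ | ⟨e, -⟩
      · rw [← hT] at e
        have : b ^ i - 1 = 0 := le_antisymm (by linarith) hw
        rw [this]
        simpa using hδ'
      · rw [← hT] at e
        rw [e, le_div_iff₀ (by positivity)] at hi
        have : 0 < b ^ i := by positivity
        nlinarith [mul_nonneg (Nat.cast_nonneg (α := ℝ) d) hρ.le]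
    · obtain ⟨t, ht, hc⟩ := exists_finset_cover_digitMap hb (i := i) (j := i + l + 2)
        (x := x k / ρ) (by omega) hj
      refine ⟨t.image (ρ * ·), Finset.card_image_le.trans (ht.trans_eq ?_), fun y hy => ?_⟩
      · congr 2
        omega
      · obtain ⟨n, hn, e⟩ := hy.1 k
        have h1 := (abs_coord_sub_le_dist y x k).trans_lt (Metric.mem_ball.1 hy.2)
        have h2 : ∀ c, |ρ * digitMap b n - ρ * c| = ρ * |digitMap b n - c| := fun c => by
          rw [← mul_sub, abs_mul, abs_of_pos hρ]
        have h3 : x k = ρ * (x k / ρ) := by field_simp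
        rw [e, h3, h2, ← lt_div_iff₀' hρ] at h1
        obtain ⟨c, hct, hcw⟩ := hc n hn h1
        refine ⟨ρ * c, Finset.mem_image_of_mem _ hct, ?_⟩
        rw [e, h2]
        gcongr
  calc (coverNumber δ' (digitSet d b ρ m ∩ Metric.ball x δ) : ℝ)
      ≤ (3 * 2 ^ (l + 2)) ^ d := by exact_mod_cast hN
    _ = 12 ^ d * (b ^ l) ^ κ := by
      rw [← Real.rpow_pow_comm hb0.le, hbκ, ← pow_mul,
        mul_comm d l, pow_mul, ← mul_pow]
      congr 1
      ring
    _ ≤ 12 ^ d * R ^ κ := by gcongr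

/-- For every dimension `κ` and every `c` there are bounded sets of dimension `κ` between the
scales `ρ` and `ρ ^ c`, with constants depending only on `d`. -/
theorem exists_homogeneous_set {c ε : ℝ} (hκ : κ ∈ Set.Icc (0 : ℝ) d) (hc : c ∈ Set.Ioo (0 : ℝ) 1)
    (hε : 0 < ε) :
    ∃ E : Set (EuclideanSpace ℝ (Fin d)), 0 ∈ E ∧ E ⊆ Metric.ball 0 1 ∧
      (∀ x δ δ', 0 < δ' → δ' ≤ δ → δ ≤ 1 →
        (coverNumber δ' (E ∩ Metric.ball x δ) : ℝ) ≤ (12 * (d + 1)) ^ d * (δ / δ') ^ κ ∧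
        (coverNumber δ' (E ∩ Metric.ball x δ) : ℝ) ≤
          (12 * (d + 1)) ^ d * (δ' ^ (c - 1)) ^ κ) ∧
      ∃ ρ : ℝ, 0 < ρ ∧ ρ < ε ∧ (d + 1) * ρ ^ c ≤ 1 ∧
        (ρ ^ (c - 1)) ^ κ ≤ coverNumber (ρ / 2) (E ∩ Metric.ball 0 ((d + 1) * ρ ^ c)) := by
  have hc1 : 0 < 1 - c := sub_pos.2 hc.2
  have hK : (1 : ℝ) ≤ (12 * (d + 1)) ^ d :=
    one_le_pow₀ (by linarith [Nat.cast_nonneg (α := ℝ) d])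
  have hsmall : ∀ᶠ ρ : ℝ in nhdsWithin 0 (Set.Ioi 0), ρ < ε ∧ (d + 1) * ρ ^ c ≤ 1 := by
    have h1 : Filter.Tendsto (fun ρ : ℝ => (d + 1) * ρ ^ c) (nhds 0) (nhds 0) := by
      have := ((Real.continuous_rpow_const hc.1.le).tendsto 0).const_mul ((d : ℝ) + 1)
      rwa [Real.zero_rpow hc.1.ne', mul_zero] at this
    exact ((eventually_lt_nhds hε).and (h1.eventually_le_const one_pos)).filter_mono
      nhdsWithin_le_nhds
  rcases hκ.1.eq_or_lt with rfl | hκ0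
  · refine ⟨{0}, rfl, by simp, fun x δ δ' hδ' _ _ => ?_, ?_⟩
    · have : (coverNumber δ' ({0} ∩ Metric.ball x δ) : ℝ) ≤ 1 := by
        exact_mod_cast (coverNumber_le {0} (by
          intro y hy
          rw [Set.mem_singleton_iff.1 hy.1]
          simpa using hδ')).trans_eq (Finset.card_singleton _)
      simp only [Real.rpow_zero, mul_one]
      exact ⟨this.trans hK, this.trans hK⟩
    · obtain ⟨ρ, ⟨h1, h2⟩, h3⟩ := (hsmall.and self_mem_nhdsWithin).exists
      have h3 : 0 < ρ := h3
      refine ⟨ρ, h3, h1, h2, ?_⟩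
      rw [Real.rpow_zero]
      exact_mod_cast one_le_coverNumber (half_pos h3) (isBounded_inter_ball _ _ _)
        ⟨0, Set.mem_singleton _, Metric.mem_ball_self (by positivity)⟩
  -- This base makes b^κ = 2^d: magnifying by b multiplies the number of points by 2^d. It requires
  -- κ > 0, and κ ≤ d gives b ≥ 2. Below, ρ is chosen so that m digits span the scales from ρ to
  -- ρ^c.
  · set b : ℝ := 2 ^ (d / κ : ℝ) with hbdef
    have hb : 2 ≤ b := by
      conv_lhs => rw [← Real.rpow_one 2]
      exact Real.rpow_le_rpow_of_exponent_le one_le_two ((one_le_div hκ0).2 hκ.2)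
    have hb0 : 0 < b := by linarith
    have hbκ : b ^ κ = 2 ^ d := by
      rw [hbdef, ← Real.rpow_mul two_pos.le, div_mul_cancel₀ _ hκ0.ne', Real.rpow_natCast]
    have htend : Filter.Tendsto (fun m : ℕ => ((b ^ m) ^ (1 / (1 - c)))⁻¹) Filter.atTop
        (nhdsWithin 0 (Set.Ioi 0)) :=
      tendsto_inv_atTop_nhdsGT_zero.comp ((tendsto_rpow_atTop (by positivity)).comp
        (tendsto_pow_atTop_atTop_of_one_lt (by linarith)))
    obtain ⟨m, hm1, hm2⟩ := (htend.eventually hsmall).exists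
    set ρ : ℝ := ((b ^ m) ^ (1 / (1 - c)))⁻¹ with hρdef
    have hρ : 0 < ρ := by positivity
    have hρc : ρ ^ (c - 1) = b ^ m := by
      rw [hρdef, Real.inv_rpow (by positivity), ← Real.rpow_neg (by positivity),
        ← Real.rpow_mul (by positivity), neg_sub, one_div_mul_cancel hc1.ne', Real.rpow_one]
    have hρb : ρ * b ^ m = ρ ^ c := by
      rw [← hρc, Real.rpow_sub_one hρ.ne']
      field_simp
    have hsub := digitSet_subset_ball (d := d) (m := m) hb hρ
    rw [hρb] at hsub
    refine ⟨digitSet d b ρ m, zero_mem_digitSet, hsub.trans (Metric.ball_subset_ball hm2),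
      fun x δ δ' hδ' hδδ hδ1 => ?_, ρ, hρ, hm1, hm2, ?_⟩
    · have hD1 : (1 : ℝ) ≤ d + 1 := by linarith [Nat.cast_nonneg (α := ℝ) d]
      have hfin : ∀ R, 1 ≤ R → (min (δ / ρ) (b ^ m) ≤
          ((d + 1) * R) * max 1 (δ' / ((d + 1) * ρ))) →
          (coverNumber δ' (digitSet d b ρ m ∩ Metric.ball x δ) : ℝ) ≤
            (12 * (d + 1)) ^ d * R ^ κ := by
        intro R hR1 hR
        refine (coverNumber_digitSet_le hb hκ.1 hbκ hρ x hδ'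
          (one_le_mul_of_one_le_of_one_le hD1 hR1) hR).trans ?_
        rw [Real.mul_rpow (by positivity) (by positivity), mul_pow, mul_assoc]
        gcongr
        rw [← Real.rpow_natCast]
        exact Real.rpow_le_rpow_of_exponent_le hD1 hκ.2
      constructor
      · refine hfin _ ((one_le_div hδ').2 hδδ) ((min_le_left _ _).trans ?_)
        calc δ / ρ = (d + 1) * (δ / δ') * (δ' / ((d + 1) * ρ)) := by field_simp
          _ ≤ _ := by
            have : 0 ≤ δ / δ' := div_nonneg (hδ'.le.trans hδδ) hδ'.le
            gcongr
            exact le_max_right _ _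
      -- This bound ignores δ: it counts the whole set at resolution δ', using b^m = ρ^(c-1).
      · refine hfin _ (Real.one_le_rpow_of_pos_of_le_one_of_nonpos hδ' (hδδ.trans hδ1)
          (by linarith [hc.2])) ((min_le_right _ _).trans ?_)
        set T := max 1 (δ' / ((d + 1) * ρ))
        have hT1 : 1 ≤ T := le_max_left _ _
        have h1 : (δ' / ((d + 1) * ρ)) ^ (1 - c) ≤ T := by
          calc _ ≤ T ^ (1 - c) :=
                Real.rpow_le_rpow (by positivity) (le_max_right _ _) hc1.le
            _ ≤ T := by
              conv_rhs => rw [← Real.rpow_one T]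
              exact Real.rpow_le_rpow_of_exponent_le hT1 (by linarith [hc.1])
        have h2 : ((d : ℝ) + 1) ^ (1 - c) ≤ d + 1 := by
          conv_rhs => rw [← Real.rpow_one ((d : ℝ) + 1)]
          exact Real.rpow_le_rpow_of_exponent_le hD1 (by linarith [hc.1])
        have h3 : δ' ^ (c - 1) = (δ' ^ (1 - c))⁻¹ := by rw [← Real.rpow_neg hδ'.le, neg_sub]
        have h4 : b ^ m = (ρ ^ (1 - c))⁻¹ := by rw [← hρc, ← Real.rpow_neg hρ.le, neg_sub]
        rw [Real.div_rpow hδ'.le (by positivity), Real.mul_rpow (by positivity) hρ.le] at h1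
        rw [h3, h4]
        calc (ρ ^ (1 - c))⁻¹ = ((d : ℝ) + 1) ^ (1 - c) * (δ' ^ (1 - c))⁻¹ *
              (δ' ^ (1 - c) / (((d : ℝ) + 1) ^ (1 - c) * ρ ^ (1 - c))) := by
              field_simp
          _ ≤ _ := by gcongr
    · rw [Set.inter_eq_left.2 hsub, hρc, ← Real.rpow_pow_comm hb0.le, hbκ, ← pow_mul, mul_comm, pow_mul]
      exact_mod_cast pow_le_coverNumber_digitSet hb hρ

end DigitSet

/-! ### Extremal functions and the realizing set -/

section Realization

variable {d : ℕ} {φ : ℝ → ℝ}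

/-- The supremum is attained at c = θ; c ≥ θ uses `hanti` and c < θ uses `hmono`. -/
theorem isLUB_spectrumFun (hmono : MonotoneOn φ (Set.Ioo (0 : ℝ) 1))
    (hanti : AntitoneOn (fun θ : ℝ => (1 - θ) * φ θ) (Set.Ioo (0 : ℝ) 1)) {θ : ℝ}
    (hθ : θ ∈ Set.Ioo (0 : ℝ) 1) :
    IsLUB ((fun p : ℝ × ℝ => spectrumFun p.1 p.2 θ / (1 - θ)) ''
      ((fun c => (φ c, c)) '' Set.Ioo (0 : ℝ) 1)) (φ θ) := by
  have hp : 0 < 1 - θ := sub_pos.2 hθ.2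
  refine IsGreatest.isLUB ⟨⟨_, ⟨θ, hθ, rfl⟩, ?_⟩, ?_⟩
  · simp only [spectrumFun, le_refl, if_true]
    field_simp
  · rintro _ ⟨_, ⟨c, hc, rfl⟩, rfl⟩
    simp only [spectrumFun]
    rw [div_le_iff₀ hp]
    split_ifs with h
    · have := hanti hθ hc h
      simp only at this
      linarith
    · have := hmono hc hθ (not_le.1 h).le
      gcongr

/-- The quotient increases to κ at θ = c and is constant afterwards. -/
theorem spectrumFun_div_le_of_le {κ c θ₁ θ₂ : ℝ} (hκ : 0 ≤ κ) (hc : c < 1) (h₂ : θ₂ < 1)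
    (hle : θ₁ ≤ θ₂) : spectrumFun κ c θ₁ / (1 - θ₁) ≤ spectrumFun κ c θ₂ / (1 - θ₂) := by
  have p₁ : 0 < 1 - θ₁ := by linarith
  have p₂ : 0 < 1 - θ₂ := by linarith
  have pc : 0 < 1 - c := by linarith
  rw [div_le_div_iff₀ p₁ p₂]
  unfold spectrumFun
  split_ifs with h h' h'
  · gcongr
  · rw [mul_assoc, mul_assoc, mul_comm (1 - θ₂)]
    gcongr
  · linarith
  · linarith

theorem spectrumFun_antitone {κ c : ℝ} (hκ : 0 ≤ κ) : Antitone (spectrumFun κ c) := by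
  intro θ₁ θ₂ hle
  unfold spectrumFun
  split_ifs with h h' h'
  · exact le_rfl
  · linarith
  · gcongr
    linarith
  · gcongr

theorem exists_set_upperAssouadSpectrum_eq_zero (d : ℕ) (hd : d = 0) :
    ∃ F : Set (EuclideanSpace ℝ (Fin d)), F.Nonempty ∧
      ∀ θ ∈ Set.Ioo (0 : ℝ) 1, upperAssouadSpectrum θ F = 0 := by
  subst hd
  refine ⟨{0}, Set.singleton_nonempty _, fun θ hθ => le_antisymm ?_ ?_⟩
  · exact csInf_le (bddBelow_upperAssouadExponents (Set.singleton_nonempty _))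
      (by simpa using natCast_mem_upperAssouadExponents (d := 0) hθ)
  · exact Real.sInf_nonneg fun α =>
      nonneg_of_mem_upperAssouadExponents (Set.singleton_nonempty _)

theorem rpow_le_div_rpow (hφ : Set.MapsTo φ (Set.Ioo (0 : ℝ) 1) (Set.Icc (0 : ℝ) d))
    (hanti : AntitoneOn (fun θ : ℝ => (1 - θ) * φ θ) (Set.Ioo (0 : ℝ) 1)) {θ c δ δ' : ℝ}
    (hθ : θ ∈ Set.Ioo (0 : ℝ) 1) (hc : c ∈ Set.Ioo (0 : ℝ) 1) (hle : θ ≤ c) (hδ : 0 < δ)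
    (hδ1 : δ ≤ 1) (hδ' : 0 < δ') (h : δ' ≤ δ ^ (1 / θ)) :
    (δ' ^ (c - 1)) ^ φ c ≤ (δ / δ') ^ φ θ := by
  have h1 := hanti hθ hc hle
  simp only at h1
  calc (δ' ^ (c - 1)) ^ φ c = δ' ^ ((c - 1) * φ c) := (Real.rpow_mul hδ'.le _ _).symm
    _ ≤ δ' ^ ((θ - 1) * φ θ) :=
      Real.rpow_le_rpow_of_exponent_ge hδ'
        ((h.trans (rpow_one_div_le_self hθ hδ hδ1)).trans hδ1) (by linarith)
    _ = (δ' ^ (θ - 1)) ^ φ θ := Real.rpow_mul hδ'.le _ _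
    _ ≤ _ := Real.rpow_le_rpow (by positivity) (rpow_sub_one_le_div hθ hδ hδ' h) (hφ hθ).1

/-- Every function with the two monotonicity properties is an upper Assouad spectrum: take a union
of far apart homogeneous sets, with `c` running through the rationals. -/
theorem exists_set_of_monotoneOn_of_antitoneOn
    (hφ : Set.MapsTo φ (Set.Ioo (0 : ℝ) 1) (Set.Icc (0 : ℝ) d))
    (hmono : MonotoneOn φ (Set.Ioo (0 : ℝ) 1))
    (hanti : AntitoneOn (fun θ : ℝ => (1 - θ) * φ θ) (Set.Ioo (0 : ℝ) 1)) :
    ∃ F : Set (EuclideanSpace ℝ (Fin d)), F.Nonempty ∧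
      ∀ θ ∈ Set.Ioo (0 : ℝ) 1, upperAssouadSpectrum θ F = φ θ := by
  -- For d = 0 there is no axis along which to separate the pieces.
  rcases Nat.eq_zero_or_pos d with hd | hd
  · obtain ⟨F, hF, h⟩ := exists_set_upperAssouadSpectrum_eq_zero d hd
    refine ⟨F, hF, fun θ hθ => (h θ hθ).trans ?_⟩
    have := hφ hθ
    simp only [hd, Nat.cast_zero, Set.Icc_self, Set.mem_singleton_iff] at this
    exact this.symm
  -- Countability lets the pieces sit at spacing 4 along an axis; the index in ℕ forces arbitrarily
  -- small ρ for each rational c.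
  let ι := {q : ℚ // (q : ℝ) ∈ Set.Ioo (0 : ℝ) 1} × ℕ
  let c : ι → ℝ := fun p => (p.1.1 : ℝ)
  have hc : ∀ p, c p ∈ Set.Ioo (0 : ℝ) 1 := fun p => p.1.2
  have hpos : ∀ p : ι, (0 : ℝ) < 1 / (p.2 + 1) := fun p => by positivity
  choose E hE0 hE1 hup ρ hρ0 hρε hρ1 hlow using
    fun p : ι => exists_homogeneous_set (hφ (hc p)) (hc p) (hpos p)
  let e : Fin d := ⟨0, hd⟩
  obtain ⟨f, hf⟩ := exists_injective_nat ι
  let v : ι → EuclideanSpace ℝ (Fin d) := fun p => EuclideanSpace.single e (4 * f p : ℝ)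
  have hv : ∀ p, v p e = 4 * f p := fun p => by simp [v]
  let F : Set (EuclideanSpace ℝ (Fin d)) := {y | ∃ p, y - v p ∈ E p}
  have hvF : ∀ p, v p ∈ F := fun p => ⟨p, by rw [sub_self]; exact hE0 p⟩
  have hsep : ∀ p x y, x - v p ∈ E p → y ∈ F → dist y x < 1 → y - v p ∈ E p := by
    rintro p x y hx ⟨q, hy⟩ hxy
    have h1 := (abs_coord_sub_le_dist _ _ e).trans_lt (Metric.mem_ball.1 (hE1 p hx))
    have h2 := (abs_coord_sub_le_dist _ _ e).trans_lt (Metric.mem_ball.1 (hE1 q hy))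
    have h3 := (abs_coord_sub_le_dist _ _ e).trans_lt hxy
    simp only [PiLp.sub_apply, PiLp.zero_apply, hv, sub_zero] at h1 h2
    rw [abs_lt] at h1 h2 h3
    have h4 : (f p : ℝ) < f q + 1 := by linarith
    have h5 : (f q : ℝ) < f p + 1 := by linarith
    have h6 : f p < f q + 1 := by exact_mod_cast h4
    have h7 : f q < f p + 1 := by exact_mod_cast h5
    rwa [hf (by omega : f p = f q)]
  have hloc : ∀ p x δ, x - v p ∈ E p → δ ≤ 1 →
      F ∩ Metric.ball x δ = {y | y - v p ∈ E p ∩ Metric.ball (x - v p) δ} := by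
    intro p x δ hx hδ
    ext y
    simp only [Set.mem_inter_iff, Metric.mem_ball, Set.mem_ofPred_eq, dist_sub_right]
    exact ⟨fun h => ⟨hsep p x y hx h.1 (h.2.trans_le hδ), h.2⟩, fun h => ⟨⟨p, h.1⟩, h.2⟩⟩
  have hFne : F.Nonempty := by
    obtain ⟨q, hq0, hq1⟩ := exists_rat_btwn (zero_lt_one (α := ℝ))
    exact ⟨_, hvF (⟨q, hq0, hq1⟩, 0)⟩
  have hle : ∀ θ ∈ Set.Ioo (0 : ℝ) 1, upperAssouadSpectrum θ F ≤ φ θ := by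
    intro θ hθ
    refine csInf_le (bddBelow_upperAssouadExponents hFne)
      ⟨(12 * (d + 1)) ^ d, by positivity, ?_⟩
    rintro δ hδ hδ1 δ' hδ' h x ⟨p, hx⟩
    have hδδ := h.trans (rpow_one_div_le_self hθ hδ hδ1)
    rw [hloc p x δ hx hδ1]
    have h1 : (coverNumber δ' {y | y - v p ∈ E p ∩ Metric.ball (x - v p) δ} : ℝ) ≤
        coverNumber δ' (E p ∩ Metric.ball (x - v p) δ) := by
      exact_mod_cast coverNumber_preimage_sub_le hδ' (isBounded_inter_ball _ _ _) _
    obtain ⟨h2, h3⟩ := hup p (x - v p) δ δ' hδ' hδδ hδ1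
    refine h1.trans ?_
    rcases le_total (c p) θ with hcθ | hcθ
    · refine h2.trans ?_
      gcongr
      · exact (one_le_div hδ').2 hδδ
      · exact hmono (hc p) hθ hcθ
    · refine h3.trans ?_
      gcongr
      exact rpow_le_div_rpow hφ hanti hθ (hc p) hcθ hδ hδ1 hδ' h
  have hge : ∀ q : {q : ℚ // (q : ℝ) ∈ Set.Ioo (0 : ℝ) 1},
      φ (q : ℚ) ≤ upperAssouadSpectrum (q : ℚ) F := by
    intro q
    refine le_csInf ⟨_, natCast_mem_upperAssouadExponents q.2⟩ ?_
    rintro α ⟨C, hC, h⟩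
    -- The test ratio is δ/δ' = 2(d+1)t for δ = (d+1)ρ^c and δ' = ρ/2. The lower bound involves only
    -- t, hence the extra factor (2(d+1))^φ(q).
    refine le_of_forall_rpow_le (C := (2 * (d + 1)) ^ φ (q : ℚ) * C) fun R => ?_
    have hq1 : 0 < 1 - ((q : ℚ) : ℝ) := sub_pos.2 q.2.2
    obtain ⟨k, hk⟩ := (((tendsto_rpow_atTop hq1).comp
      (Filter.tendsto_atTop_add_const_right _ (1 : ℝ)
        tendsto_natCast_atTop_atTop)).eventually_gt_atTop R).exists
    let p : ι := (q, k)
    set t : ℝ := ρ p ^ (c p - 1) with ht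
    have hρ := hρ0 p
    have ht0 : 0 < t := by positivity
    have hRt : R < t := by
      refine hk.trans_le ?_
      rw [ht, show c p - 1 = -(1 - ((q : ℚ) : ℝ)) from (neg_sub _ _).symm, Real.rpow_neg hρ.le, ← Real.inv_rpow hρ.le]
      refine Real.rpow_le_rpow (by positivity) ?_ hq1.le
      rw [le_inv_comm₀ (by positivity) hρ, ← one_div]
      exact (hρε p).le
    have hD : (1 : ℝ) ≤ d + 1 := by linarith [Nat.cast_nonneg (α := ℝ) d]
    have hρc : 0 < ρ p ^ c p := by positivity
    have hratio : (d + 1) * ρ p ^ c p / (ρ p / 2) = 2 * (d + 1) * t := by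
      rw [ht, Real.rpow_sub_one hρ.ne']
      field_simp
    have h1 := h ((d + 1) * ρ p ^ c p) (by positivity) (hρ1 p) (ρ p / 2) (half_pos hρ) (by
      calc ρ p / 2 ≤ ρ p := (half_lt_self hρ).le
        _ = (ρ p ^ c p) ^ (1 / c p) := by
          rw [← Real.rpow_mul hρ.le, mul_one_div_cancel (hc p).1.ne', Real.rpow_one]
        _ ≤ _ := by
          refine Real.rpow_le_rpow hρc.le ?_ (one_div_pos.2 (hc p).1).le
          nlinarith) (v p) (hvF p)
    have h2 : (coverNumber (ρ p / 2) (E p ∩ Metric.ball 0 ((d + 1) * ρ p ^ c p)) : ℝ) ≤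
        coverNumber (ρ p / 2) (F ∩ Metric.ball (v p) ((d + 1) * ρ p ^ c p)) := by
      have h3 := coverNumber_preimage_sub_le (half_pos hρ)
        (isBounded_inter_ball F (v p) ((d + 1) * ρ p ^ c p)) (-v p)
      rw [hloc p (v p) _ (by rw [sub_self]; exact hE0 p) (hρ1 p)] at h3 ⊢
      simp only [sub_neg_eq_add, Set.mem_ofPred_eq, add_sub_cancel_right, sub_self,
        Set.ofPred_mem_eq] at h3 ⊢
      exact_mod_cast h3
    rw [hratio] at h1
    refine ⟨2 * (d + 1) * t, by nlinarith, ?_⟩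
    rw [Real.mul_rpow (by positivity) ht0.le, mul_assoc _ C]
    gcongr
    exact (hlow p).trans (h2.trans h1)
  refine ⟨F, hFne, fun θ hθ => (hle θ hθ).antisymm ?_⟩
  set ψ := upperAssouadSpectrum θ F with hψ
  by_contra! hlt
  have hp : 0 < 1 - θ := sub_pos.2 hθ.2
  -- For q < θ this close, (1-θ)φ(θ) ≤ (1-q)φ(q) ≤ (1-q)ψ gives (1-θ)(φ(θ)-ψ) ≤ (θ-q)ψ, which is
  -- impossible since ψ < φ(θ) ≤ d.
  have hε : 0 < (1 - θ) * (φ θ - ψ) / (d + 1) :=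
    div_pos (mul_pos hp (sub_pos.2 hlt)) (by positivity)
  obtain ⟨q, hq, hqθ⟩ := exists_rat_btwn (show max 0 (θ - (1 - θ) * (φ θ - ψ) / (d + 1)) < θ from
    max_lt hθ.1 (by linarith))
  have hq01 : (q : ℝ) ∈ Set.Ioo (0 : ℝ) 1 :=
    ⟨(le_max_left _ _).trans_lt hq, hqθ.trans hθ.2⟩
  have h1 : φ q ≤ ψ :=
    (hge ⟨q, hq01⟩).trans (monotoneOn_upperAssouadSpectrum hFne hq01 hθ hqθ.le)
  have h2 := hanti hq01 hθ hqθ.le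
  simp only at h2
  have h3 := (le_max_right _ _).trans_lt hq
  rw [sub_lt_comm, lt_div_iff₀ (by positivity)] at h3
  have h4 := (hφ hθ).2
  nlinarith [mul_nonneg (sub_nonneg.2 hqθ.le) (sub_nonneg.2 (hlt.le.trans h4)),
    mul_le_mul_of_nonneg_left h1 (sub_nonneg.2 hq01.2.le)]

end Realization

end AssouadSpec

/-! ### The equivalence -/

theorem mainTheorem3 (d : ℕ) (φ : ℝ → ℝ)
    (hφ : Set.MapsTo φ (Set.Ioo (0 : ℝ) 1) (Set.Icc (0 : ℝ) (d : ℝ))) :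
    List.TFAE
      [∃ F : Set (EuclideanSpace ℝ (Fin d)), F.Nonempty ∧
          ∀ θ ∈ Set.Ioo (0 : ℝ) 1, AssouadSpec.upperAssouadSpectrum θ F = φ θ,
        MonotoneOn φ (Set.Ioo (0 : ℝ) 1) ∧
          AntitoneOn (fun θ : ℝ => (1 - θ) * φ θ) (Set.Ioo (0 : ℝ) 1),
        ∃ P : Set (ℝ × ℝ), P ⊆ Set.Icc (0 : ℝ) (d : ℝ) ×ˢ Set.Ioo (0 : ℝ) 1 ∧
          ∀ θ ∈ Set.Ioo (0 : ℝ) 1,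
            IsLUB ((fun p : ℝ × ℝ => AssouadSpec.spectrumFun p.1 p.2 θ / (1 - θ)) '' P) (φ θ)] := by
  tfae_have 1 → 2 := by
    rintro ⟨F, hF, h⟩
    refine ⟨(AssouadSpec.monotoneOn_upperAssouadSpectrum hF).congr h,
      (AssouadSpec.antitoneOn_upperAssouadSpectrum hF).congr fun θ hθ => ?_⟩
    simp only [h θ hθ]
  tfae_have 2 → 1 := fun h =>
    AssouadSpec.exists_set_of_monotoneOn_of_antitoneOn hφ h.1 h.2
  tfae_have 2 → 3 := by
    rintro ⟨hmono, hanti⟩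
    refine ⟨(fun c => (φ c, c)) '' Set.Ioo (0 : ℝ) 1, ?_, fun θ hθ =>
      AssouadSpec.isLUB_spectrumFun hmono hanti hθ⟩
    rintro _ ⟨c, hc, rfl⟩
    exact ⟨hφ hc, hc⟩
  tfae_have 3 → 2 := by
    rintro ⟨P, hP, h⟩
    refine ⟨fun θ₁ h₁ θ₂ h₂ hle => (h θ₁ h₁).2 ?_, fun θ₁ h₁ θ₂ h₂ hle => ?_⟩
    · rintro _ ⟨p, hp, rfl⟩
      exact (AssouadSpec.spectrumFun_div_le_of_le (hP hp).1.1 (hP hp).2.2 h₂.2 hle).trans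
        ((h θ₂ h₂).1 ⟨p, hp, rfl⟩)
    · have p₁ : 0 < 1 - θ₁ := sub_pos.2 h₁.2
      have p₂ : 0 < 1 - θ₂ := sub_pos.2 h₂.2
      show (1 - θ₂) * φ θ₂ ≤ (1 - θ₁) * φ θ₁
      rw [← le_div_iff₀' p₂]
      refine (h θ₂ h₂).2 ?_
      rintro _ ⟨p, hp, rfl⟩
      have h3 := (h θ₁ h₁).1 ⟨p, hp, rfl⟩
      simp only [div_le_iff₀ p₁] at h3
      simp only
      gcongr
      linarith [AssouadSpec.spectrumFun_antitone (c := p.2) (hP hp).1.1 hle]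
  tfae_finish
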